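/- Corollary 2. Let $n=a+b+c$ with integers $a,b,c\ge 0$. Consider the $n\times n$ square grid together with its $4n$ external edges ($n$ on each side). A fully packed loop (FPL) configuration is a set of occupied edges such that each of the $n^2$ grid vertices lies on exactly two occupied edges and every other one of the $4n$ external edges, in cyclic order around the square, is occupied. It is of type $(A,B,C)$ if $A,B,C$ are unoccupied external edges, in this cyclic order, such that the number of occupied external edges between $A$ and $B$ is $a+b$, between $B$ and $C$ is $b+c$, and between $C$ and $A$ is $c+a$, and if the paths formed by the occupied edges connect the occupied external edges in three sets of $a$, $b$ and $c$ nested arches centred at $A$, $B$ and $C$ respectively: for $1\le j\le a$ the $j$-th occupied external edges on the two sides of $A$ are connected by a path, and likewise for $1\le j\le b$ around $B$ and for $1\le j\le c$ around $C$. Then no FPL configuration of type $(A,B,C)$ contains a closed loop, that is, its occupied edges contain no cycle. -/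

import Mathlib

/-- Two points of `ℤ × ℤ` are neighbours when they are at distance one along a coordinate axis. -/
def LatticeNeighbour (u v : ℤ × ℤ) : Prop :=
  |u.1 - v.1| + |u.2 - v.2| = 1

/-- The vertices of the `n × n` square grid: the points `(x, y)` with `1 ≤ x, y ≤ n`. -/
def gridVertices (n : ℕ) : Set (ℤ × ℤ) :=
  {v | 1 ≤ v.1 ∧ v.1 ≤ (n : ℤ) ∧ 1 ≤ v.2 ∧ v.2 ≤ (n : ℤ)}

/-- The outer endpoint of the `k`-th external edge. The `4 n` external edges are numbered cyclically
and counterclockwise, by integers modulo `4 n`: the bottom side from left to right, the right side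
from bottom to top, the top side from right to left, the left side from top to bottom. -/
def outerEnd (n : ℕ) (k : ℤ) : ℤ × ℤ :=
  let r : ℤ := k % (4 * (n : ℤ))
  if r < n then (r + 1, 0)
  else if r < 2 * n then (n + 1, r - n + 1)
  else if r < 3 * n then (3 * n - r, n + 1)
  else (0, 4 * n - r)

/-- The inner endpoint of the `k`-th external edge: the only vertex of the grid that is a neighbour
of its outer endpoint. -/
def innerEnd (n : ℕ) (k : ℤ) : ℤ × ℤ :=
  let r : ℤ := k % (4 * (n : ℤ))
  if r < n then (r + 1, 1)
  else if r < 2 * n then (n, r - n + 1)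
  else if r < 3 * n then (3 * n - r, n)
  else (1, 4 * n - r)

/-- The `k`-th external edge is occupied in the configuration `H`. -/
def ExternalOccupied (n : ℕ) (H : SimpleGraph (ℤ × ℤ)) (k : ℤ) : Prop :=
  H.Adj (innerEnd n k) (outerEnd n k)

/-- `H`, the graph of occupied edges, is a configuration of fully packed loops on the `n × n` grid.
An occupied edge joins two lattice neighbours, at least one of them in the grid (so it is an
internal edge or one of the `4 n` external edges). -/
structure IsFPL (n : ℕ) (H : SimpleGraph (ℤ × ℤ)) : Prop where
  neighbour_of_adj : ∀ u v, H.Adj u v → LatticeNeighbour u v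
  mem_grid_of_adj : ∀ u v, H.Adj u v → u ∈ gridVertices n ∨ v ∈ gridVertices n
  /-- Each vertex of the grid is visited exactly once: it lies on exactly two occupied edges. -/
  two_edges : ∀ v ∈ gridVertices n, (H.neighborSet v).ncard = 2
  /-- Every other external edge is occupied. -/
  alternating : ∀ k : ℤ, ExternalOccupied n H (k + 1) ↔ ¬ ExternalOccupied n H k

/-- `m` nested arches centred at the external edge number `X`: that edge is unoccupied and, for
`j = 0, …, m - 1`, a path of the configuration connects the two external edges at distance `2 j + 1`
on either side of it (that is, the `(j + 1)`-st occupied external edges on either side). -/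
def NestedArches (n : ℕ) (H : SimpleGraph (ℤ × ℤ)) (X : ℤ) (m : ℕ) : Prop :=
  ¬ ExternalOccupied n H X ∧
    ∀ j : ℕ, j < m → H.Reachable (outerEnd n (X - (2 * j + 1))) (outerEnd n (X + (2 * j + 1)))

/-- `H` is a fully packed loop configuration of type `(A, B, C)` on the `n × n` grid: its link
pattern consists of three sets of `a`, `b` and `c` nested arches, `a + b + c = n`, centred at the
unoccupied external edges `A`, `B`, `C`, in this counterclockwise order; there are `a + b` occupied
external edges between `A` and `B`, `b + c` between `B` and `C` and (hence) `c + a` between `C` and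
`A`. -/
structure IsFPLOfType (n a b c : ℕ) (A B C : ℤ) (H : SimpleGraph (ℤ × ℤ)) : Prop where
  isFPL : IsFPL n H
  sum_eq : a + b + c = n
  A_to_B : B ≡ A + 2 * (a + b) [ZMOD 4 * n]
  B_to_C : C ≡ B + 2 * (b + c) [ZMOD 4 * n]
  archesA : NestedArches n H A a
  archesB : NestedArches n H B b
  archesC : NestedArches n H C c

/-! All degrees are at most two, so a component containing a cycle has no vertex of degree one. It
therefore suffices to connect every grid vertex to a loose end, that is, to the outer endpoint of an
occupied external edge. Suppose this fails, and take a vertex z with least coordinate sum among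
those not connected to a loose end: its two edges go right and up.

Consider a quadrant bounded by the two diagonals through an apex of suitable parity. Summing degrees
with chessboard signs shows that exactly as many occupied edges leave it as it contains loose ends
(`HasPhase.card_leaving_southCone`). If every loose end in the quadrant is joined to one outside,
these paths leave along distinct edges and so exhaust the leaving edges: each of them is connected
to a loose end (`HasPhase.isTight_southCone`).

The nested arches supply this hypothesis unless one of the three centres is interior to the boundary
interval cut out by the quadrant (`IsFPLOfType.exists_partner`). Near z there are four quadrants of
the right parity, each crossed by an edge at z, and no centre is interior to two of them. As four
exceeds three, one quadrant avoids all centres and connects z to a loose end, a contradiction. -/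

namespace SimpleGraph

/-! ### Graphs of maximal degree two -/

variable {V : Type*} {G : SimpleGraph V}

theorem Reachable.mem_of_closed {S : Set V} (hS : ∀ u ∈ S, ∀ v, G.Adj u v → v ∈ S) {u v : V}
    (h : G.Reachable u v) (hu : u ∈ S) : v ∈ S := by
  obtain ⟨p⟩ := h
  induction p with
  | nil => exact hu
  | cons hadj _ ih => exact ih (hS _ hu _ hadj)

/-- A vertex with at most one neighbour. -/
def AtMostOneNeighbour (G : SimpleGraph V) (v : V) : Prop :=
  ∀ w w', G.Adj v w → G.Adj v w' → w = w'

/-- Every vertex has at most two neighbours. -/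
def AtMostTwoNeighbours (G : SimpleGraph V) : Prop :=
  ∀ v, (G.neighborSet v).Finite ∧ (G.neighborSet v).ncard ≤ 2

theorem AtMostTwoNeighbours.subgraph_adj (hG : G.AtMostTwoNeighbours) {K : G.Subgraph} {v w : V}
    (hv : (K.neighborSet v).ncard = 2) (h : G.Adj v w) : K.Adj v w := by
  have heq : K.neighborSet v = G.neighborSet v :=
    Set.eq_of_subset_of_ncard_le (K.neighborSet_subset v) (by rw [hv]; exact (hG v).2) (hG v).1
  have : w ∈ G.neighborSet v := h
  rw [← heq] at this
  exact this

theorem AtMostOneNeighbour.ncard_subgraph_ne_two {v : V} (hv : G.AtMostOneNeighbour v)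
    (K : G.Subgraph) : (K.neighborSet v).ncard ≠ 2 := by
  intro h
  obtain ⟨a, b, hab, hs⟩ := Set.ncard_eq_two.mp h
  have ha : a ∈ K.neighborSet v := by simp [hs]
  have hb : b ∈ K.neighborSet v := by simp [hs]
  exact hab (hv a b (K.adj_sub ha) (K.adj_sub hb))

/-- In a graph of maximal degree at most two, three vertices of degree at most one are not all in
the same component. -/
theorem AtMostTwoNeighbours.not_reachable_of_reachable (hG : G.AtMostTwoNeighbours) {x y z : V}
    (hx : G.AtMostOneNeighbour x) (hy : G.AtMostOneNeighbour y) (hz : G.AtMostOneNeighbour z)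
    (hxy : x ≠ y) (hxz : x ≠ z) (hyz : y ≠ z) (h : G.Reachable x y) : ¬ G.Reachable x z := by
  intro h'
  obtain ⟨p, hp⟩ := h.exists_isPath
  have hnil : ¬ p.Nil := fun hn => hxy hn.eq
  -- The path is a whole component: its inner vertices already have both their neighbours on it, and
  -- its ends have their only one. So `z` would be an inner vertex, of degree two.
  have hcl : ∀ u ∈ {w | w ∈ p.support}, ∀ v, G.Adj u v → v ∈ {w | w ∈ p.support} := by
    intro u hu v huv
    obtain ⟨i, rfl, hi⟩ := (Walk.mem_support_iff_exists_getVert).mp hu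
    rcases Nat.eq_zero_or_pos i with rfl | h0
    · have := hx v p.snd (by simpa using huv) (p.adj_snd hnil)
      subst this
      exact p.getVert_mem_support 1
    rcases hi.eq_or_lt with rfl | hlt
    · have := hy v p.penultimate (by simpa using huv) (p.adj_penultimate hnil).symm
      subst this
      exact p.getVert_mem_support _
    · have := hG.subgraph_adj
        (hp.ncard_neighborSet_toSubgraph_internal_eq_two h0.ne' hlt) huv
      exact p.mem_verts_toSubgraph.mp this.snd_mem
  obtain ⟨i, hi, hil⟩ := (Walk.mem_support_iff_exists_getVert).mp
    (h'.mem_of_closed hcl p.start_mem_support)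
  subst hi
  refine hz.ncard_subgraph_ne_two p.toSubgraph
    (hp.ncard_neighborSet_toSubgraph_internal_eq_two ?_ (lt_of_le_of_ne hil ?_))
  · rintro rfl
    simp at hxz
  · rintro rfl
    simp at hyz

/-- A graph of maximal degree at most two is acyclic if each vertex is connected
to a vertex with at most one neighbour. -/
theorem AtMostTwoNeighbours.isAcyclic (hG : G.AtMostTwoNeighbours)
    (h : ∀ v, ∃ o, G.AtMostOneNeighbour o ∧ G.Reachable v o) : G.IsAcyclic := by
  intro v c hc
  obtain ⟨o, ho, hvo⟩ := h v
  -- The cycle exhausts the degrees of its vertices, so nothing else is reachable from it.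
  have hcl : ∀ u ∈ {w | w ∈ c.support}, ∀ v, G.Adj u v → v ∈ {w | w ∈ c.support} := by
    intro u hu v huv
    exact c.mem_verts_toSubgraph.mp
      (hG.subgraph_adj (hc.ncard_neighborSet_toSubgraph_eq_two hu) huv).snd_mem
  exact ho.ncard_subgraph_ne_two _ (hc.ncard_neighborSet_toSubgraph_eq_two
    (hvo.mem_of_closed hcl c.start_mem_support))

end SimpleGraph

/-! ### Loose ends and tight sets -/

/-- `o` is the outer endpoint of an occupied external edge of `H`. -/
def IsOuterLeaf (n : ℕ) (H : SimpleGraph (ℤ × ℤ)) (o : ℤ × ℤ) : Prop :=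
  o ∉ gridVertices n ∧ ∃ w, H.Adj o w

/-- If the loose ends in `D` all lead out of `D` and belong to different paths, then these paths
use all the edges that leave `D`. -/
def IsTight (n : ℕ) (H : SimpleGraph (ℤ × ℤ)) (D : Set (ℤ × ℤ)) : Prop :=
  (∀ o ∈ D, IsOuterLeaf n H o → ∃ q ∉ D, H.Reachable o q) →
  (∀ o ∈ D, ∀ o' ∈ D, IsOuterLeaf n H o → IsOuterLeaf n H o' → H.Reachable o o' → o = o') →
  ∀ u ∈ D, ∀ v ∉ D, H.Adj u v → ∃ o, IsOuterLeaf n H o ∧ H.Reachable u o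

/-- Tightness is invariant under symmetries of the grid, which reduces the four kinds of cone to the
southern one. -/
theorem IsTight.of_comap {n : ℕ} {H : SimpleGraph (ℤ × ℤ)} {D : Set (ℤ × ℤ)}
    (T : (ℤ × ℤ) ≃ (ℤ × ℤ)) (hT : ∀ w, T w ∈ gridVertices n ↔ w ∈ gridVertices n)
    (h : IsTight n (H.comap T) (T ⁻¹' D)) : IsTight n H D := by
  have hr : ∀ a b, (H.comap T).Reachable a b ↔ H.Reachable (T a) (T b) := fun a b =>
    (SimpleGraph.Iso.reachable_iff (φ := SimpleGraph.Iso.comap T H)).symm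
  have hl : ∀ a, IsOuterLeaf n (H.comap T) a ↔ IsOuterLeaf n H (T a) := by
    intro a
    unfold IsOuterLeaf
    rw [hT]
    refine and_congr_right fun _ => ⟨fun ⟨w, hw⟩ => ⟨T w, hw⟩, fun ⟨w, hw⟩ => ⟨T.symm w, ?_⟩⟩
    simpa using hw
  intro h1 h2 u hu v hv huv
  have h3 : ∀ o ∈ T ⁻¹' D, IsOuterLeaf n (H.comap T) o →
      ∃ q ∉ T ⁻¹' D, (H.comap T).Reachable o q := by
    intro o ho hlo
    obtain ⟨q, hq, hrq⟩ := h1 _ ho ((hl o).mp hlo)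
    exact ⟨T.symm q, by simpa using hq, (hr _ _).mpr (by simpa using hrq)⟩
  have h4 : ∀ o ∈ T ⁻¹' D, ∀ o' ∈ T ⁻¹' D, IsOuterLeaf n (H.comap T) o →
      IsOuterLeaf n (H.comap T) o' → (H.comap T).Reachable o o' → o = o' := by
    intro o ho o' ho' hlo hlo' hroo
    exact T.injective (h2 _ ho _ ho' ((hl _).mp hlo) ((hl _).mp hlo') ((hr _ _).mp hroo))
  obtain ⟨o, ho, hro⟩ := h h3 h4 (T.symm u) (by simpa using hu) (T.symm v) (by simpa using hv)
    (by simpa using huv)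
  exact ⟨T o, (hl o).mp ho, by simpa using (hr _ _).mp hro⟩

/-! ### Parity of the boundary and symmetries of the square -/

/-- A fully packed loop configuration whose occupied external edges are described by a parity
`p`: those at the bottom and the top end in grid vertices `(x, y)` with `x + y + p` even, those on
the left and the right in grid vertices with `x + y + p` odd. -/
structure HasPhase (n : ℕ) (p : ℤ) (H : SimpleGraph (ℤ × ℤ)) : Prop where
  neighbour_of_adj : ∀ u v, H.Adj u v → LatticeNeighbour u v
  mem_grid_of_adj : ∀ u v, H.Adj u v → u ∈ gridVertices n ∨ v ∈ gridVertices n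
  two_edges : ∀ v ∈ gridVertices n, (H.neighborSet v).ncard = 2
  bottom : ∀ x : ℤ, 1 ≤ x → x ≤ n → (H.Adj (x, 1) (x, 0) ↔ Even (x + 1 + p))
  top : ∀ x : ℤ, 1 ≤ x → x ≤ n → (H.Adj (x, n) (x, n + 1) ↔ Even (x + n + p))
  left : ∀ y : ℤ, 1 ≤ y → y ≤ n → (H.Adj (1, y) (0, y) ↔ Odd (1 + y + p))
  right : ∀ y : ℤ, 1 ≤ y → y ≤ n → (H.Adj (n, y) (n + 1, y) ↔ Odd (n + y + p))

/-- Reflection of the grid in its horizontal axis. -/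
def gridFlip (n : ℕ) : (ℤ × ℤ) ≃ (ℤ × ℤ) where
  toFun w := (w.1, n + 1 - w.2)
  invFun w := (w.1, n + 1 - w.2)
  left_inv w := by ext <;> simp
  right_inv w := by ext <;> simp

theorem gridFlip_mem (n : ℕ) (w : ℤ × ℤ) : gridFlip n w ∈ gridVertices n ↔ w ∈ gridVertices n := by
  simp only [gridFlip, gridVertices, Equiv.coe_fn_mk, Set.mem_ofPred_eq]
  omega

theorem prodComm_mem (n : ℕ) (w : ℤ × ℤ) :
    Equiv.prodComm ℤ ℤ w ∈ gridVertices n ↔ w ∈ gridVertices n := by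
  simp only [gridVertices, Equiv.prodComm_apply, Set.mem_ofPred_eq, Prod.fst_swap, Prod.snd_swap]
  omega

theorem ncard_neighborSet_comap {V : Type*} (G : SimpleGraph V) (T : V ≃ V) (v : V) :
    ((G.comap T).neighborSet v).ncard = (G.neighborSet (T v)).ncard := by
  have : (G.comap T).neighborSet v = T ⁻¹' (G.neighborSet (T v)) := by
    ext w; simp
  rw [this, ← Equiv.image_symm_eq_preimage, Set.ncard_image_of_injective _ T.symm.injective]

/-- Replacing `y` by `n + 1 - y` changes the parity of `x + y` by that of `n - 1`; bottom and top
are exchanged. -/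
theorem HasPhase.comap_gridFlip {n : ℕ} {p : ℤ} {H : SimpleGraph (ℤ × ℤ)} (h : HasPhase n p H) :
    HasPhase n (p + n - 1) (H.comap (gridFlip n)) where
  neighbour_of_adj u v huv := by
    have := h.neighbour_of_adj _ _ huv
    simp only [LatticeNeighbour, gridFlip, Equiv.coe_fn_mk] at this ⊢
    rw [← this]
    congr 1
    rw [← abs_neg]
    ring_nf
  mem_grid_of_adj u v huv := by
    simpa [gridFlip_mem] using h.mem_grid_of_adj _ _ huv
  two_edges v hv := by
    rw [ncard_neighborSet_comap]
    exact h.two_edges _ ((gridFlip_mem n v).mpr hv)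
  bottom x h1 h2 := by
    have := h.top x h1 h2
    simp only [SimpleGraph.comap_adj, gridFlip, Equiv.coe_fn_mk, add_sub_cancel_right, sub_zero]
    rw [this]
    simp only [Int.even_iff]
    omega
  top x h1 h2 := by
    have := h.bottom x h1 h2
    simp only [SimpleGraph.comap_adj, gridFlip, Equiv.coe_fn_mk, add_sub_cancel_left, sub_self]
    rw [this]
    simp only [Int.even_iff]
    omega
  left y h1 h2 := by
    have := h.left (n + 1 - y) (by omega) (by omega)
    simp only [SimpleGraph.comap_adj, gridFlip, Equiv.coe_fn_mk]
    rw [this]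
    simp only [Int.odd_iff]
    omega
  right y h1 h2 := by
    have := h.right (n + 1 - y) (by omega) (by omega)
    simp only [SimpleGraph.comap_adj, gridFlip, Equiv.coe_fn_mk]
    rw [this]
    simp only [Int.odd_iff]
    omega

/-- Horizontal and vertical sides obey opposite parity conditions, so exchanging them shifts the
phase by one. -/
theorem HasPhase.comap_prodComm {n : ℕ} {p : ℤ} {H : SimpleGraph (ℤ × ℤ)} (h : HasPhase n p H) :
    HasPhase n (p + 1) (H.comap (Equiv.prodComm ℤ ℤ)) where
  neighbour_of_adj u v huv := by
    have := h.neighbour_of_adj _ _ huv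
    simp only [LatticeNeighbour, Equiv.prodComm_apply, Prod.fst_swap, Prod.snd_swap] at this ⊢
    rw [← this, add_comm]
  mem_grid_of_adj u v huv := by
    have := h.mem_grid_of_adj _ _ huv
    rwa [prodComm_mem, prodComm_mem] at this
  two_edges v hv := by
    rw [ncard_neighborSet_comap]
    exact h.two_edges _ ((prodComm_mem n v).mpr hv)
  bottom x h1 h2 := by
    refine (h.left x h1 h2).trans ?_
    simp only [Int.even_iff, Int.odd_iff]
    omega
  top x h1 h2 := by
    refine (h.right x h1 h2).trans ?_
    simp only [Int.even_iff, Int.odd_iff]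
    omega
  left y h1 h2 := by
    refine (h.bottom y h1 h2).trans ?_
    simp only [Int.even_iff, Int.odd_iff]
    omega
  right y h1 h2 := by
    refine (h.top y h1 h2).trans ?_
    simp only [Int.even_iff, Int.odd_iff]
    omega

theorem LatticeNeighbour.eq_or {u v : ℤ × ℤ} (h : LatticeNeighbour u v) :
    v = (u.1 + 1, u.2) ∨ v = (u.1 - 1, u.2) ∨ v = (u.1, u.2 + 1) ∨ v = (u.1, u.2 - 1) := by
  unfold LatticeNeighbour at h
  simp only [Prod.ext_iff]
  rcases abs_cases (u.1 - v.1) with ⟨h1, _⟩ | ⟨h1, _⟩ <;>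
    rcases abs_cases (u.2 - v.2) with ⟨h2, _⟩ | ⟨h2, _⟩ <;> omega

/-- The outer endpoints of occupied external edges, together with their neighbours. -/
theorem HasPhase.outer_cases {n : ℕ} {p : ℤ} {H : SimpleGraph (ℤ × ℤ)} (h : HasPhase n p H)
    {o w : ℤ × ℤ} (ho : o ∉ gridVertices n) (how : H.Adj o w) :
    (1 ≤ w.1 ∧ w.1 ≤ n ∧ w.2 = 1 ∧ o.1 = w.1 ∧ o.2 = 0 ∧ Odd (o.1 + o.2 + p)) ∨
    (1 ≤ w.1 ∧ w.1 ≤ n ∧ w.2 = n ∧ o.1 = w.1 ∧ o.2 = n + 1 ∧ Odd (o.1 + o.2 + p)) ∨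
    (1 ≤ w.2 ∧ w.2 ≤ n ∧ w.1 = 1 ∧ o.2 = w.2 ∧ o.1 = 0 ∧ Even (o.1 + o.2 + p)) ∨
    (1 ≤ w.2 ∧ w.2 ≤ n ∧ w.1 = n ∧ o.2 = w.2 ∧ o.1 = n + 1 ∧ Even (o.1 + o.2 + p)) := by
  have hw : w ∈ gridVertices n := (h.mem_grid_of_adj _ _ how).resolve_left ho
  have hadj := how.symm
  have hn := (h.neighbour_of_adj _ _ hadj).eq_or
  obtain ⟨x, y⟩ := w
  simp only [gridVertices, Set.mem_ofPred_eq] at hw ho hn ⊢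
  rcases hn with rfl | rfl | rfl | rfl
  · have hx : x = n := by simp only at ho; omega
    subst hx
    have := (h.right y hw.2.2.1 hw.2.2.2).mp hadj
    refine Or.inr (Or.inr (Or.inr ?_))
    simp only [Int.even_iff, Int.odd_iff, true_and] at this ⊢
    omega
  · have hx : x = 1 := by simp only at ho; omega
    subst hx
    have := (h.left y hw.2.2.1 hw.2.2.2).mp hadj
    refine Or.inr (Or.inr (Or.inl ?_))
    simp only [Int.even_iff, Int.odd_iff, true_and] at this ⊢
    omega
  · have hx : y = n := by simp only at ho; omega
    subst hx
    have := (h.top x hw.1 hw.2.1).mp hadj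
    refine Or.inr (Or.inl ?_)
    simp only [Int.even_iff, Int.odd_iff, true_and] at this ⊢
    omega
  · have hx : y = 1 := by simp only at ho; omega
    subst hx
    have := (h.bottom x hw.1 hw.2.1).mp hadj
    refine Or.inl ?_
    simp only [Int.even_iff, Int.odd_iff, true_and] at this ⊢
    omega

theorem HasPhase.atMostOneNeighbour {n : ℕ} {p : ℤ} {H : SimpleGraph (ℤ × ℤ)}
    (h : HasPhase n p H) {o : ℤ × ℤ} (ho : o ∉ gridVertices n) : H.AtMostOneNeighbour o := by
  intro w w' hw hw'
  have h1 := h.outer_cases ho hw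
  have h2 := h.outer_cases ho hw'
  have := h.mem_grid_of_adj _ _ hw
  have := h.mem_grid_of_adj _ _ hw'
  simp only [gridVertices, Set.mem_ofPred_eq] at *
  ext <;> omega

theorem HasPhase.atMostTwoNeighbours {n : ℕ} {p : ℤ} {H : SimpleGraph (ℤ × ℤ)}
    (h : HasPhase n p H) : H.AtMostTwoNeighbours := by
  intro v
  by_cases hv : v ∈ gridVertices n
  · have := h.two_edges v hv
    exact ⟨Set.finite_of_ncard_ne_zero (by omega), this.le⟩
  · have hs : (H.neighborSet v).Subsingleton := fun a ha b hb => h.atMostOneNeighbour hv a b ha hb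
    exact ⟨hs.finite, ((Set.ncard_le_one hs.finite).mpr fun a ha b hb => hs ha hb).trans
      one_le_two⟩

/-! ### Cones and the count of edges leaving them -/

/-- The lattice points in the closed quadrant below `(a, b)` that is bounded by the two diagonals
through `(a, b)`. -/
def southCone (a b : ℤ) : Set (ℤ × ℤ) := {w | w.1 + w.2 ≤ a + b ∧ a - b ≤ w.1 - w.2}

/-- The quadrant above `(a, b)`. -/
def northCone (a b : ℤ) : Set (ℤ × ℤ) := {w | a + b ≤ w.1 + w.2 ∧ w.1 - w.2 ≤ a - b}

/-- The quadrant to the right of `(a, b)`. -/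
def eastCone (a b : ℤ) : Set (ℤ × ℤ) := {w | a + b ≤ w.1 + w.2 ∧ a - b ≤ w.1 - w.2}

/-- The quadrant to the left of `(a, b)`. -/
def westCone (a b : ℤ) : Set (ℤ × ℤ) := {w | w.1 + w.2 ≤ a + b ∧ w.1 - w.2 ≤ a - b}

theorem sum_Icc_alternating (m : ℕ) :
    ∑ y ∈ Finset.Icc (1 : ℤ) m, (if Even (y + m) then (1 : ℤ) else -1) =
      if Odd (m : ℤ) then 1 else 0 := by
  induction m with
  | zero => simp
  | succ m ih =>
    have hI : Finset.Icc (1 : ℤ) ((m + 1 : ℕ) : ℤ) =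
        insert ((m : ℤ) + 1) (Finset.Icc (1 : ℤ) m) := by
      ext y
      simp only [Finset.mem_Icc, Finset.mem_insert]
      omega
    have hneg : ∀ y ∈ Finset.Icc (1 : ℤ) m,
        (if Even (y + ((m + 1 : ℕ) : ℤ)) then (1 : ℤ) else -1) =
          -(if Even (y + (m : ℤ)) then (1 : ℤ) else -1) := by
      intro y _
      push_cast
      simp only [Int.even_iff]
      split_ifs <;> omega
    rw [hI, Finset.sum_insert (by simp), Finset.sum_congr rfl hneg, Finset.sum_neg_distrib, ih]
    push_cast
    simp only [Int.even_iff, Int.odd_iff]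
    split_ifs <;> omega

theorem sum_Icc_truncated_alternating (n : ℕ) (t : ℤ) (ht : t ≤ n) :
    ∑ y ∈ Finset.Icc (1 : ℤ) n, (if y ≤ t then (if Even (y + t) then (1 : ℤ) else -1) else 0) =
      if 0 ≤ t ∧ Odd t then 1 else 0 := by
  rw [← Finset.sum_filter]
  rcases le_or_gt 0 t with h | h
  · obtain ⟨m, rfl⟩ := Int.eq_ofNat_of_zero_le h
    have : (Finset.Icc (1 : ℤ) n).filter (· ≤ (m : ℤ)) = Finset.Icc (1 : ℤ) m := by
      ext y
      simp only [Finset.mem_filter, Finset.mem_Icc]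
      omega
    rw [this, sum_Icc_alternating]
    simp
  · rw [Finset.filter_false_of_mem, Finset.sum_empty, if_neg]
    · omega
    · intro y hy
      simp only [Finset.mem_Icc] at hy
      omega

/-- The grid together with a frame of width one, which contains the outer endpoints. -/
noncomputable def framedGrid (n : ℕ) : Finset (ℤ × ℤ) :=
  Finset.Icc (0 : ℤ) (n + 1) ×ˢ Finset.Icc (0 : ℤ) (n + 1)

theorem HasPhase.mem_framedGrid {n : ℕ} {p : ℤ} {H : SimpleGraph (ℤ × ℤ)} (h : HasPhase n p H)
    {u v : ℤ × ℤ} (huv : H.Adj u v) : u ∈ framedGrid n := by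
  have h1 := h.mem_grid_of_adj _ _ huv
  have h2 := (h.neighbour_of_adj _ _ huv).eq_or
  simp only [gridVertices, framedGrid, Set.mem_ofPred_eq, Finset.mem_product,
    Finset.mem_Icc, Prod.ext_iff] at *
  omega

open Classical in
/-- The number of occupied edges at a vertex. -/
noncomputable def fplDegree (n : ℕ) (H : SimpleGraph (ℤ × ℤ)) (v : ℤ × ℤ) : ℤ :=
  ∑ w ∈ framedGrid n, if H.Adj v w then 1 else 0

theorem HasPhase.fplDegree_eq_ncard {n : ℕ} {p : ℤ} {H : SimpleGraph (ℤ × ℤ)} (h : HasPhase n p H)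
    (v : ℤ × ℤ) : fplDegree n H v = (H.neighborSet v).ncard := by
  classical
  have : H.neighborSet v = ((framedGrid n).filter (H.Adj v) : Finset (ℤ × ℤ)) := by
    ext w
    simp only [SimpleGraph.mem_neighborSet, Finset.coe_filter, Set.mem_ofPred_eq]
    exact ⟨fun hw => ⟨h.mem_framedGrid hw.symm, hw⟩, fun hw => hw.2⟩
  rw [this, Set.ncard_coe_finset, Finset.card_filter, fplDegree]
  push_cast
  rfl

theorem HasPhase.fplDegree_of_mem {n : ℕ} {p : ℤ} {H : SimpleGraph (ℤ × ℤ)} (h : HasPhase n p H)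
    {v : ℤ × ℤ} (hv : v ∈ gridVertices n) : fplDegree n H v = 2 := by
  rw [h.fplDegree_eq_ncard, h.two_edges v hv]
  rfl

open Classical in
theorem HasPhase.fplDegree_of_notMem {n : ℕ} {p : ℤ} {H : SimpleGraph (ℤ × ℤ)}
    (h : HasPhase n p H) {v : ℤ × ℤ} (hv : v ∉ gridVertices n) :
    fplDegree n H v = if IsOuterLeaf n H v then 1 else 0 := by
  rw [h.fplDegree_eq_ncard]
  split_ifs with hl
  · obtain ⟨w, hw⟩ := hl.2
    have : H.neighborSet v = {w} := by
      ext w'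
      exact ⟨fun hw' => h.atMostOneNeighbour hv _ _ hw' hw, fun hw' => by
        rw [Set.mem_singleton_iff] at hw'
        exact hw' ▸ hw⟩
    rw [this]
    simp
  · have : H.neighborSet v = ∅ := by
      ext w'
      simp only [SimpleGraph.mem_neighborSet, Set.mem_empty_iff_false, iff_false]
      exact fun hw' => hl ⟨hv, w', hw'⟩
    rw [this]
    simp

theorem HasPhase.isOuterLeaf_bottom_iff {n : ℕ} {p : ℤ} {H : SimpleGraph (ℤ × ℤ)}
    (h : HasPhase n p H) {x : ℤ} (h1 : 1 ≤ x) (h2 : x ≤ n) :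
    IsOuterLeaf n H (x, 0) ↔ Odd (x + p) := by
  constructor
  · rintro ⟨ho, w, hw⟩
    have := h.outer_cases ho hw
    simp only [Int.even_iff, Int.odd_iff] at *
    omega
  · intro hx
    refine ⟨by simp [gridVertices], (x, 1), ((h.bottom x h1 h2).mpr ?_).symm⟩
    simp only [Int.even_iff, Int.odd_iff] at *
    omega

/-- The colour of a vertex: `1` on the sublattice of `(a, b)` and `-1` elsewhere. -/
def colour (a b : ℤ) (w : ℤ × ℤ) : ℤ := if Even (w.1 + w.2 + (a + b)) then 1 else -1

theorem colour_of_neighbour {a b : ℤ} {u v : ℤ × ℤ} (h : LatticeNeighbour u v) :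
    colour a b v = -colour a b u := by
  have := h.eq_or
  simp only [colour, Int.even_iff, Prod.ext_iff] at *
  split_ifs <;> omega

/-- A unit step changes each of `w.1 + w.2` and `w.1 - w.2` by one, so it can leave the cone only
from a bounding diagonal, and both diagonals lie on the sublattice of the apex. -/
theorem colour_of_boundary_southCone {a b : ℤ} {u v : ℤ × ℤ} (h : LatticeNeighbour u v)
    (hu : u ∈ southCone a b) (hv : v ∉ southCone a b) : colour a b u = 1 := by
  have := h.eq_or
  simp only [colour, southCone, Set.mem_ofPred_eq, Int.even_iff, Prod.ext_iff] at *
  split_ifs <;> omega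

open Classical in
/-- Edges inside of the cone cancel in the sum of the degrees with signs. -/
theorem HasPhase.sum_colour_mul_fplDegree {n : ℕ} {p : ℤ} {H : SimpleGraph (ℤ × ℤ)}
    (h : HasPhase n p H) (a b : ℤ) :
    ∑ u ∈ framedGrid n with u ∈ southCone a b, colour a b u * fplDegree n H u =
      ∑ u ∈ framedGrid n with u ∈ southCone a b, ∑ v ∈ framedGrid n with v ∉ southCone a b,
        if H.Adj u v then 1 else 0 := by
  set D := (framedGrid n).filter (· ∈ southCone a b) with hD
  have hsplit : ∀ u, fplDegree n H u = (∑ v ∈ D, if H.Adj u v then (1 : ℤ) else 0) +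
      ∑ v ∈ framedGrid n with v ∉ southCone a b, if H.Adj u v then (1 : ℤ) else 0 := fun u =>
    (Finset.sum_filter_add_sum_filter_not _ _ _).symm
  have hin : ∑ u ∈ D, colour a b u * (∑ v ∈ D, if H.Adj u v then (1 : ℤ) else 0) = 0 := by
    -- An inner edge is counted from both ends, which have opposite colours: exchanging `u` and `v`
    -- turns the sum into its negative.
    have h1 : ∑ u ∈ D, colour a b u * (∑ v ∈ D, if H.Adj u v then (1 : ℤ) else 0) =
        -∑ u ∈ D, colour a b u * (∑ v ∈ D, if H.Adj u v then (1 : ℤ) else 0) := by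
      conv_lhs => simp only [Finset.mul_sum]
      rw [Finset.sum_comm, ← Finset.sum_neg_distrib]
      refine Finset.sum_congr rfl fun u _ => ?_
      rw [Finset.mul_sum, ← Finset.sum_neg_distrib]
      refine Finset.sum_congr rfl fun v _ => ?_
      by_cases huv : H.Adj u v
      · rw [colour_of_neighbour (h.neighbour_of_adj _ _ huv), if_pos huv, if_pos huv.symm]
        ring
      · rw [if_neg huv, if_neg fun hvu => huv hvu.symm]
        ring
    omega
  simp only [hsplit, mul_add, Finset.sum_add_distrib]
  rw [hin, zero_add]
  refine Finset.sum_congr rfl fun u hu => ?_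
  rw [Finset.mul_sum]
  refine Finset.sum_congr rfl fun v hv => ?_
  split_ifs with huv
  · rw [colour_of_boundary_southCone (h.neighbour_of_adj _ _ huv) (Finset.mem_filter.mp hu).2
      (Finset.mem_filter.mp hv).2, mul_one]
  · rw [mul_zero]

open Classical in
-- The count holds column by column. In a grid column cut at height `t`, the signed degrees of the
-- grid vertices sum to 2 if `t` is odd and nonnegative, and to 0 otherwise. The parity of the apex
-- makes the bottom edge occupied exactly for odd `t`, and then its loose end has colour -1, leaving
-- 2 - 1 = 1. In the other columns only loose ends of the left and right sides matter, and these
-- have colour 1.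
theorem HasPhase.column_sum {n : ℕ} {p : ℤ} {H : SimpleGraph (ℤ × ℤ)}
    (h : HasPhase n p H) {a b : ℤ} (hab : Even (a + b + p)) (hb : b ≤ n) (x : ℤ) :
    ∑ y ∈ Finset.Icc (0 : ℤ) (n + 1), (if (x, y) ∈ southCone a b then
      colour a b (x, y) * fplDegree n H (x, y) else 0) =
    ∑ y ∈ Finset.Icc (0 : ℤ) (n + 1), (if (x, y) ∈ southCone a b then
      if IsOuterLeaf n H (x, y) then (1 : ℤ) else 0 else 0) := by
  by_cases hx' : 1 ≤ x ∧ x ≤ n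
  · have hI : Finset.Icc (0 : ℤ) (n + 1) = insert 0 (insert ((n : ℤ) + 1) (Finset.Icc 1 (n : ℤ))) := by
      ext y
      simp only [Finset.mem_Icc, Finset.mem_insert]
      omega
    have h0 : (0 : ℤ) ∉ insert ((n : ℤ) + 1) (Finset.Icc 1 (n : ℤ)) := by
      simp only [Finset.mem_Icc, Finset.mem_insert]
      omega
    have h1 : (n : ℤ) + 1 ∉ Finset.Icc 1 (n : ℤ) := by
      simp
    have htop : (x, (n : ℤ) + 1) ∉ southCone a b := by
      simp only [southCone, Set.mem_ofPred_eq]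
      omega
    -- `t` is the height of the cone in column `x`; as `t ≤ b ≤ n`, the top loose end is never
    -- included.
    obtain ⟨t, ht1, ht⟩ : ∃ t : ℤ, t ≤ b ∧ (t = b - (x - a) ∧ a ≤ x ∨ t = b - (a - x) ∧ x ≤ a) := by
      rcases le_total a x with hax | hax
      · exact ⟨b - (x - a), by omega, Or.inl ⟨rfl, hax⟩⟩
      · exact ⟨b - (a - x), by omega, Or.inr ⟨rfl, hax⟩⟩
    have hmem : ∀ y, (x, y) ∈ southCone a b ↔ y ≤ t := by
      intro y
      simp only [southCone, Set.mem_ofPred_eq]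
      omega
    have hcol : ∀ y, colour a b (x, y) = if Even (y + t) then 1 else -1 := by
      intro y
      simp only [colour, Int.even_iff]
      congr 1
      simp only [eq_iff_iff]
      omega
    have hsum1 : ∑ y ∈ Finset.Icc (1 : ℤ) n, (if (x, y) ∈ southCone a b then
        colour a b (x, y) * fplDegree n H (x, y) else 0) =
        2 * if 0 ≤ t ∧ Odd t then 1 else 0 := by
      rw [← sum_Icc_truncated_alternating n t (by omega), Finset.mul_sum]
      refine Finset.sum_congr rfl fun y hy => ?_
      rw [Finset.mem_Icc] at hy
      rw [h.fplDegree_of_mem (v := (x, y)) ⟨hx'.1, hx'.2, hy.1, hy.2⟩, hcol]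
      simp only [hmem]
      split_ifs <;> rfl
    have hsum2 : ∑ y ∈ Finset.Icc (1 : ℤ) n, (if (x, y) ∈ southCone a b then
        if IsOuterLeaf n H (x, y) then (1 : ℤ) else 0 else 0) = 0 := by
      refine Finset.sum_eq_zero fun y hy => ?_
      rw [Finset.mem_Icc] at hy
      rw [if_neg fun hl : IsOuterLeaf n H (x, y) => hl.1 ⟨hx'.1, hx'.2, hy.1, hy.2⟩, ite_self]
    rw [hI, Finset.sum_insert h0, Finset.sum_insert h1, Finset.sum_insert h0, Finset.sum_insert h1,
      hsum1, hsum2, if_neg htop, if_neg htop,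
      h.fplDegree_of_notMem (v := (x, 0)) (by simp [gridVertices]), hcol]
    simp only [hmem, h.isOuterLeaf_bottom_iff hx'.1 hx'.2, Int.even_iff, Int.odd_iff] at hab ⊢
    split_ifs <;> omega
  · refine Finset.sum_congr rfl fun y _ => ?_
    have hg : (x, y) ∉ gridVertices n := fun hg => hx' ⟨hg.1, hg.2.1⟩
    rw [h.fplDegree_of_notMem hg]
    by_cases hl : IsOuterLeaf n H (x, y)
    · obtain ⟨w, hw⟩ := hl.2
      have := h.outer_cases hg hw
      rw [if_pos hl]
      have hc : colour a b (x, y) = 1 := by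
        simp only [colour, Int.even_iff, Int.odd_iff] at hab this ⊢
        rw [if_pos]
        omega
      rw [hc, one_mul]
    · rw [if_neg hl, mul_zero]

open Classical in
/-- If `(a, b)` is on the right sublattice, as many occupied edges leave the cone below `(a, b)` as
there are occupied external edges in it. -/
theorem HasPhase.card_leaving_southCone {n : ℕ} {p : ℤ} {H : SimpleGraph (ℤ × ℤ)}
    (h : HasPhase n p H) {a b : ℤ} (hab : Even (a + b + p)) (hb : b ≤ n) :
    (((framedGrid n).filter (· ∈ southCone a b) ×ˢ (framedGrid n).filter (· ∉ southCone a b)).filter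
      fun e => H.Adj e.1 e.2).card =
    (((framedGrid n).filter (· ∈ southCone a b)).filter (IsOuterLeaf n H)).card := by
  zify
  rw [Finset.card_filter, Finset.card_filter, Finset.sum_product]
  push_cast
  rw [← h.sum_colour_mul_fplDegree, Finset.sum_filter, Finset.sum_filter, framedGrid,
    Finset.sum_product, Finset.sum_product]
  exact Finset.sum_congr rfl fun x _ => h.column_sum hab hb x

/-- Each path from a loose end in the cone has to cross the boundary. Picking one crossing edge per
loose end is injective because the paths differ, hence surjective onto the leaving edges because the
two numbers agree. -/
theorem HasPhase.isTight_southCone {n : ℕ} {p : ℤ} {H : SimpleGraph (ℤ × ℤ)}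
    (h : HasPhase n p H) {a b : ℤ} (hab : Even (a + b + p)) (hb : b ≤ n) :
    IsTight n H (southCone a b) := by
  classical
  intro hexit hsep u hu v hv huv
  set L := ((framedGrid n).filter (· ∈ southCone a b)).filter (IsOuterLeaf n H) with hL
  set X := ((framedGrid n).filter (· ∈ southCone a b) ×ˢ
    (framedGrid n).filter (· ∉ southCone a b)).filter fun e => H.Adj e.1 e.2 with hX
  have hLmem : ∀ o ∈ L, o ∈ southCone a b ∧ IsOuterLeaf n H o := by
    intro o ho
    simp only [hL, Finset.mem_filter] at ho
    exact ⟨ho.1.2, ho.2⟩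
  have hXmem : ∀ e, e ∈ X ↔ e.1 ∈ southCone a b ∧ e.2 ∉ southCone a b ∧ H.Adj e.1 e.2 := by
    intro e
    simp only [hX, Finset.mem_filter, Finset.mem_product]
    exact ⟨fun he => ⟨he.1.1.2, he.1.2.2, he.2⟩, fun he =>
      ⟨⟨⟨h.mem_framedGrid he.2.2, he.1⟩, ⟨h.mem_framedGrid he.2.2.symm, he.2.1⟩⟩, he.2.2⟩⟩
  have hex : ∀ o, ∃ e, o ∈ L → e ∈ X ∧ H.Reachable o e.1 := by
    intro o
    by_cases ho : o ∈ L
    · obtain ⟨hoS, hol⟩ := hLmem o ho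
      obtain ⟨q, hq, ⟨w⟩⟩ := hexit o hoS hol
      -- `d` is a step of the walk from inside the cone to outside, so its inner end is still
      -- connected to `o`.
      obtain ⟨d, hd, hd1, hd2⟩ := w.exists_boundary_dart _ hoS hq
      refine ⟨(d.fst, d.snd), fun _ => ⟨(hXmem _).mpr ⟨hd1, hd2, d.adj⟩, ?_⟩⟩
      exact ⟨w.takeUntil _ (w.dart_fst_mem_support_of_mem_darts hd)⟩
    · exact ⟨(o, o), fun ho' => absurd ho' ho⟩
  choose c hc using hex
  have hinj : Set.InjOn c L := by
    intro o ho o' ho' hoo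
    have h1 := hc o ho
    have h2 := hc o' ho'
    rw [← hoo] at h2
    exact hsep o (hLmem o ho).1 o' (hLmem o' ho').1 (hLmem o ho).2 (hLmem o' ho').2
      (h1.2.trans h2.2.symm)
  have hsurj := Finset.surjOn_of_injOn_of_card_le c (fun o ho => (hc o ho).1) hinj
    (h.card_leaving_southCone hab hb).le
  obtain ⟨o, ho, hoe⟩ := hsurj ((hXmem (u, v)).mpr ⟨hu, hv, huv⟩)
  refine ⟨o, (hLmem o ho).2, ?_⟩
  have := (hc o ho).2
  rw [hoe] at this
  exact this.symm

theorem HasPhase.isTight_northCone {n : ℕ} {p : ℤ} {H : SimpleGraph (ℤ × ℤ)}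
    (h : HasPhase n p H) {a b : ℤ} (hab : Even (a + b + p)) (hb : 1 ≤ b) :
    IsTight n H (northCone a b) := by
  refine IsTight.of_comap (gridFlip n) (gridFlip_mem n) ?_
  have : gridFlip n ⁻¹' northCone a b = southCone a (n + 1 - b) := by
    ext w
    simp only [northCone, southCone, gridFlip, Set.mem_preimage, Equiv.coe_fn_mk,
      Set.mem_ofPred_eq]
    omega
  rw [this]
  refine h.comap_gridFlip.isTight_southCone ?_ (by omega)
  rw [Int.even_iff] at *
  omega

theorem HasPhase.isTight_westCone {n : ℕ} {p : ℤ} {H : SimpleGraph (ℤ × ℤ)}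
    (h : HasPhase n p H) {a b : ℤ} (hab : Odd (a + b + p)) (ha : a ≤ n) :
    IsTight n H (westCone a b) := by
  refine IsTight.of_comap (Equiv.prodComm ℤ ℤ) (prodComm_mem n) ?_
  have : Equiv.prodComm ℤ ℤ ⁻¹' westCone a b = southCone b a := by
    ext w
    simp only [westCone, southCone, Set.mem_preimage, Equiv.prodComm_apply, Prod.fst_swap,
      Prod.snd_swap, Set.mem_ofPred_eq]
    omega
  rw [this]
  refine h.comap_prodComm.isTight_southCone ?_ ha
  rw [Int.even_iff, Int.odd_iff] at *
  omega

theorem HasPhase.isTight_eastCone {n : ℕ} {p : ℤ} {H : SimpleGraph (ℤ × ℤ)}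
    (h : HasPhase n p H) {a b : ℤ} (hab : Odd (a + b + p)) (ha : 1 ≤ a) :
    IsTight n H (eastCone a b) := by
  refine IsTight.of_comap (Equiv.prodComm ℤ ℤ) (prodComm_mem n) ?_
  have : Equiv.prodComm ℤ ℤ ⁻¹' eastCone a b = northCone b a := by
    ext w
    simp only [eastCone, northCone, Set.mem_preimage, Equiv.prodComm_apply, Prod.fst_swap,
      Prod.snd_swap, Set.mem_ofPred_eq]
    omega
  rw [this]
  refine h.comap_prodComm.isTight_northCone ?_ ha
  rw [Int.even_iff, Int.odd_iff] at *
  omega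

/-! ### The cyclic order of the external edges -/

theorem outerEnd_add_mul (n : ℕ) (k m : ℤ) : outerEnd n (k + 4 * n * m) = outerEnd n k := by
  simp only [outerEnd, Int.add_mul_emod_self_left]

theorem outerEnd_of_lt {n : ℕ} {k : ℤ} (h0 : 0 ≤ k) (h4 : k < 4 * n) :
    (k < n ∧ outerEnd n k = (k + 1, 0)) ∨
    (n ≤ k ∧ k < 2 * n ∧ outerEnd n k = ((n : ℤ) + 1, k - n + 1)) ∨
    (2 * n ≤ k ∧ k < 3 * n ∧ outerEnd n k = (3 * n - k, (n : ℤ) + 1)) ∨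
    (3 * n ≤ k ∧ outerEnd n k = (0, 4 * n - k)) := by
  simp only [outerEnd, Int.emod_eq_of_lt h0 h4]
  split_ifs <;> simp <;> omega

/-- The range contains every window of length `4 * n` starting at `-n`, `0`, `n` or `2 * n`, the
places where the circle is cut open for the four cones. -/
theorem outerEnd_of_lt' {n : ℕ} {k : ℤ} (h0 : -n ≤ k) (h4 : k < 6 * n) :
    (k < 0 ∧ outerEnd n k = (0, -k)) ∨
    (0 ≤ k ∧ k < n ∧ outerEnd n k = (k + 1, 0)) ∨
    (n ≤ k ∧ k < 2 * n ∧ outerEnd n k = ((n : ℤ) + 1, k - n + 1)) ∨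
    (2 * n ≤ k ∧ k < 3 * n ∧ outerEnd n k = (3 * n - k, (n : ℤ) + 1)) ∨
    (3 * n ≤ k ∧ k < 4 * n ∧ outerEnd n k = (0, 4 * n - k)) ∨
    (4 * n ≤ k ∧ k < 5 * n ∧ outerEnd n k = (k - 4 * n + 1, 0)) ∨
    (5 * n ≤ k ∧ outerEnd n k = ((n : ℤ) + 1, k - 5 * n + 1)) := by
  rcases lt_or_ge k 0 with hk | hk
  · have := outerEnd_of_lt (n := n) (k := k + 4 * n * 1) (by omega) (by omega)
    rw [outerEnd_add_mul] at this
    rcases this with h | h | h | ⟨_, h⟩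
    iterate 3 exfalso; omega
    exact Or.inl ⟨hk, h.trans (by ext <;> simp only; omega)⟩
  rcases lt_or_ge k (4 * n) with hk' | hk'
  · rcases outerEnd_of_lt hk hk' with h | h | h | h
    · exact Or.inr (Or.inl ⟨hk, h⟩)
    · exact Or.inr (Or.inr (Or.inl h))
    · exact Or.inr (Or.inr (Or.inr (Or.inl h)))
    · exact Or.inr (Or.inr (Or.inr (Or.inr (Or.inl ⟨h.1, hk', h.2⟩))))
  · have := outerEnd_of_lt (n := n) (k := k + 4 * n * (-1)) (by omega) (by omega)
    rw [outerEnd_add_mul] at this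
    rcases this with ⟨h1, h⟩ | ⟨h1, h2, h⟩ | h | h
    · exact Or.inr (Or.inr (Or.inr (Or.inr (Or.inr (Or.inl ⟨hk', by omega,
        h.trans (by ext <;> simp only; omega)⟩)))))
    · exact Or.inr (Or.inr (Or.inr (Or.inr (Or.inr (Or.inr ⟨by omega,
        h.trans (by ext <;> simp only; omega)⟩)))))
    iterate 2 exfalso; omega

/-- The outer endpoints in `D` are consecutive in the cyclic order. -/
def IsRingInterval (n : ℕ) (D : Set (ℤ × ℤ)) : Prop :=
  ∃ s : ℤ, ∀ k₁ k k₂ : ℤ, s ≤ k₁ → k₁ ≤ k → k ≤ k₂ → k₂ < s + 4 * n →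
    outerEnd n k₁ ∈ D → outerEnd n k₂ ∈ D → outerEnd n k ∈ D

/-- With its apex in the grid, the cone contains no outer endpoint of the top side, so the circle
may be cut at `-n`, just after that side. The other cones are likewise cut just after the side
opposite to them. -/
theorem isRingInterval_southCone {n : ℕ} {a b : ℤ} (hg : (a, b) ∈ gridVertices n) :
    IsRingInterval n (southCone a b) := by
  refine ⟨-n, fun k₁ k k₂ h1 h2 h3 h4 m1 m2 => ?_⟩
  have e1 := outerEnd_of_lt' (n := n) (k := k₁) (by omega) (by omega)
  have e2 := outerEnd_of_lt' (n := n) (k := k₂) (by omega) (by omega)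
  have e := outerEnd_of_lt' (n := n) (k := k) (by omega) (by omega)
  simp only [gridVertices, southCone, Set.mem_ofPred_eq, Prod.ext_iff] at *
  rcases e with e | e | e | e | e | e | e <;> rcases e1 with e1 | e1 | e1 | e1 | e1 | e1 | e1 <;>
    omega

theorem isRingInterval_eastCone {n : ℕ} {a b : ℤ} (hg : (a, b) ∈ gridVertices n) :
    IsRingInterval n (eastCone a b) := by
  refine ⟨0, fun k₁ k k₂ h1 h2 h3 h4 m1 m2 => ?_⟩
  have e1 := outerEnd_of_lt' (n := n) (k := k₁) (by omega) (by omega)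
  have e2 := outerEnd_of_lt' (n := n) (k := k₂) (by omega) (by omega)
  have e := outerEnd_of_lt' (n := n) (k := k) (by omega) (by omega)
  simp only [gridVertices, eastCone, Set.mem_ofPred_eq, Prod.ext_iff] at *
  rcases e with e | e | e | e | e | e | e <;> rcases e1 with e1 | e1 | e1 | e1 | e1 | e1 | e1 <;>
    omega

theorem isRingInterval_northCone {n : ℕ} {a b : ℤ} (hg : (a, b) ∈ gridVertices n) :
    IsRingInterval n (northCone a b) := by
  refine ⟨n, fun k₁ k k₂ h1 h2 h3 h4 m1 m2 => ?_⟩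
  have e1 := outerEnd_of_lt' (n := n) (k := k₁) (by omega) (by omega)
  have e2 := outerEnd_of_lt' (n := n) (k := k₂) (by omega) (by omega)
  have e := outerEnd_of_lt' (n := n) (k := k) (by omega) (by omega)
  simp only [gridVertices, northCone, Set.mem_ofPred_eq, Prod.ext_iff] at *
  rcases e with e | e | e | e | e | e | e <;> rcases e1 with e1 | e1 | e1 | e1 | e1 | e1 | e1 <;>
    omega

theorem isRingInterval_westCone {n : ℕ} {a b : ℤ} (hg : (a, b) ∈ gridVertices n) :
    IsRingInterval n (westCone a b) := by
  refine ⟨2 * n, fun k₁ k k₂ h1 h2 h3 h4 m1 m2 => ?_⟩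
  have e1 := outerEnd_of_lt' (n := n) (k := k₁) (by omega) (by omega)
  have e2 := outerEnd_of_lt' (n := n) (k := k₂) (by omega) (by omega)
  have e := outerEnd_of_lt' (n := n) (k := k) (by omega) (by omega)
  simp only [gridVertices, westCone, Set.mem_ofPred_eq, Prod.ext_iff] at *
  rcases e with e | e | e | e | e | e | e <;> rcases e1 with e1 | e1 | e1 | e1 | e1 | e1 | e1 <;>
    omega

theorem exists_add_mul_mem_window {n : ℕ} (hn : 0 < n) (s k : ℤ) :
    ∃ m : ℤ, s ≤ k + 4 * n * m ∧ k + 4 * n * m < s + 4 * n := by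
  refine ⟨-((k - s) / (4 * n)), ?_⟩
  have h1 := Int.emod_nonneg (k - s) (b := 4 * (n : ℤ)) (by omega)
  have h2 := Int.emod_lt_of_pos (k - s) (b := 4 * (n : ℤ)) (by omega)
  have h3 := Int.emod_add_mul_ediv (k - s) (4 * (n : ℤ))
  rw [mul_neg]
  constructor <;> linarith

/-- The outer endpoints next to the `X`-th one are both in `D`. -/
def IsInterior (n : ℕ) (D : Set (ℤ × ℤ)) (X : ℤ) : Prop :=
  outerEnd n (X - 1) ∈ D ∧ outerEnd n (X + 1) ∈ D

/-- An interval containing both ends of an arch contains one of the two arcs between them. One arc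
surrounds `X`; the bounds on `e` put `Y` with both its neighbours on the other. -/
theorem IsRingInterval.isInterior_or {n : ℕ} (hn : 0 < n) {D : Set (ℤ × ℤ)}
    (hD : IsRingInterval n D) {X Y d e : ℤ} (hd : 1 ≤ d) (hdn : d < 2 * n) (hde : d + 1 ≤ e)
    (hed : e + d + 1 ≤ 4 * n) (hY : Y ≡ X + e [ZMOD 4 * n]) (h1 : outerEnd n (X - d) ∈ D)
    (h2 : outerEnd n (X + d) ∈ D) : IsInterior n D X ∨ IsInterior n D Y := by
  obtain ⟨s, hs⟩ := hD
  obtain ⟨m₁, h3, h4⟩ := exists_add_mul_mem_window hn s (X - d)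
  obtain ⟨m₂, h5, h6⟩ := exists_add_mul_mem_window hn s (X + d)
  have hn' : (0 : ℤ) < n := by exact_mod_cast hn
  -- The ends are `2 * d < 4 * n` apart, so in the window they either keep their order or are
  -- swapped by one full turn. These cases correspond to the two arcs.
  have hm : m₂ = m₁ ∨ m₂ = m₁ - 1 := by
    have h7 : m₂ - m₁ < 1 := by
      by_contra hc
      nlinarith
    have h8 : -2 < m₂ - m₁ := by
      by_contra hc
      nlinarith
    omega
  rcases hm with rfl | rfl
  · left
    rw [← outerEnd_add_mul n _ m₂] at h1 h2
    have := hs _ (X - 1 + 4 * n * m₂) _ h3 (by linarith) (by linarith) h6 h1 h2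
    have := hs _ (X + 1 + 4 * n * m₂) _ h3 (by linarith) (by linarith) h6 h1 h2
    simp only [outerEnd_add_mul] at *
    exact ⟨by assumption, by assumption⟩
  · right
    obtain ⟨q, hq⟩ := hY.dvd
    rw [← outerEnd_add_mul n _ m₁] at h1
    rw [← outerEnd_add_mul n _ (m₁ - 1)] at h2
    rw [mul_sub] at h5 h6
    have := hs _ (Y - 1 + 4 * n * (m₁ - 1 + q)) _ (by linarith) (by linarith) (by linarith)
      h4 h2 h1
    have := hs _ (Y + 1 + 4 * n * (m₁ - 1 + q)) _ (by linarith) (by linarith) (by linarith)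
      h4 h2 h1
    simp only [outerEnd_add_mul] at *
    exact ⟨by assumption, by assumption⟩

theorem outerEnd_notMem {n : ℕ} (hn : 0 < n) (k : ℤ) : outerEnd n k ∉ gridVertices n := by
  obtain ⟨m, h1, h2⟩ := exists_add_mul_mem_window hn 0 k
  rw [← outerEnd_add_mul n k m]
  have := outerEnd_of_lt (n := n) h1 (by omega)
  simp only [gridVertices, Set.mem_ofPred_eq, Prod.ext_iff] at *
  omega

/-! ### External edges of a configuration: parity and arches -/

theorem IsFPL.exists_parity {n : ℕ} {H : SimpleGraph (ℤ × ℤ)} (h : IsFPL n H) :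
    ∃ p : ℤ, ∀ k, ExternalOccupied n H k ↔ Even (k + p) := by
  have key : ∀ p : ℤ, (ExternalOccupied n H 0 ↔ Even (0 + p)) →
      ∀ k, ExternalOccupied n H k ↔ Even (k + p) := by
    intro p h0 k
    induction k using Int.induction_on with
    | zero => exact h0
    | succ i ih =>
      rw [h.alternating, ih, Int.even_iff, Int.even_iff]
      omega
    | pred i ih =>
      have := h.alternating (-i - 1)
      rw [sub_add_cancel, ih] at this
      rw [← not_iff_not, ← this, Int.even_iff, Int.even_iff]
      omega
  by_cases h0 : ExternalOccupied n H 0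
  · exact ⟨0, key 0 (by simp [h0])⟩
  · exact ⟨1, key 1 (by simp [h0])⟩

theorem IsFPL.hasPhase {n : ℕ} {H : SimpleGraph (ℤ × ℤ)} (h : IsFPL n H) {p : ℤ}
    (hp : ∀ k, ExternalOccupied n H k ↔ Even (k + p)) : HasPhase n p H where
  neighbour_of_adj := h.neighbour_of_adj
  mem_grid_of_adj := h.mem_grid_of_adj
  two_edges := h.two_edges
  bottom x h1 h2 := by
    have := hp (x - 1)
    simp only [ExternalOccupied, innerEnd, outerEnd,
      Int.emod_eq_of_lt (show 0 ≤ x - 1 by omega) (show x - 1 < 4 * (n : ℤ) by omega)] at this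
    rw [if_pos (by omega), if_pos (by omega), sub_add_cancel] at this
    rw [this, Int.even_iff, Int.even_iff]
    omega
  right y h1 h2 := by
    have := hp (n + y - 1)
    simp only [ExternalOccupied, innerEnd, outerEnd, Int.emod_eq_of_lt
      (show 0 ≤ n + y - 1 by omega) (show n + y - 1 < 4 * (n : ℤ) by omega)] at this
    rw [if_neg (by omega), if_pos (by omega), if_neg (by omega), if_pos (by omega),
      show (n : ℤ) + y - 1 - n + 1 = y by ring] at this
    rw [this, Int.even_iff, Int.odd_iff]
    omega
  top x h1 h2 := by
    have := hp (3 * n - x)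
    simp only [ExternalOccupied, innerEnd, outerEnd, Int.emod_eq_of_lt
      (show 0 ≤ 3 * n - x by omega) (show 3 * n - x < 4 * (n : ℤ) by omega)] at this
    rw [if_neg (by omega), if_neg (by omega), if_pos (by omega), if_neg (by omega),
      if_neg (by omega), if_pos (by omega), sub_sub_cancel] at this
    rw [this, Int.even_iff, Int.even_iff]
    omega
  left y h1 h2 := by
    have := hp (4 * n - y)
    simp only [ExternalOccupied, innerEnd, outerEnd, Int.emod_eq_of_lt
      (show 0 ≤ 4 * n - y by omega) (show 4 * n - y < 4 * (n : ℤ) by omega)] at this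
    rw [if_neg (by omega), if_neg (by omega), if_neg (by omega), if_neg (by omega),
      if_neg (by omega), if_neg (by omega), sub_sub_cancel] at this
    rw [this, Int.even_iff, Int.odd_iff]
    omega

/-- An outer endpoint of an occupied external edge is the `k`-th one for some `k` of the right
parity. -/
theorem HasPhase.exists_outerEnd_eq {n : ℕ} {p : ℤ} {H : SimpleGraph (ℤ × ℤ)}
    (h : HasPhase n p H) {o : ℤ × ℤ} (ho : IsOuterLeaf n H o) :
    ∃ k, outerEnd n k = o ∧ Even (k + p) := by
  obtain ⟨hg, w, hw⟩ := ho
  have hc := h.outer_cases hg hw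
  rcases hc with hc | hc | hc | hc
  · refine ⟨o.1 - 1, ?_, ?_⟩
    · have := outerEnd_of_lt (n := n) (k := o.1 - 1) (by omega) (by omega)
      simp only [Prod.ext_iff] at *
      omega
    · rw [Int.even_iff, Int.odd_iff] at *
      omega
  · refine ⟨3 * n - o.1, ?_, ?_⟩
    · have := outerEnd_of_lt (n := n) (k := 3 * n - o.1) (by omega) (by omega)
      simp only [Prod.ext_iff] at *
      omega
    · rw [Int.even_iff, Int.odd_iff] at *
      omega
  · refine ⟨4 * n - o.2, ?_, ?_⟩
    · have := outerEnd_of_lt (n := n) (k := 4 * n - o.2) (by omega) (by omega)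
      simp only [Prod.ext_iff] at *
      omega
    · rw [Int.even_iff] at *
      omega
  · refine ⟨n + o.2 - 1, ?_, ?_⟩
    · have := outerEnd_of_lt (n := n) (k := n + o.2 - 1) (by omega) (by omega)
      simp only [Prod.ext_iff] at *
      omega
    · rw [Int.even_iff] at *
      omega

/-- Every occupied external edge belongs to one of the arches centred at `A`, `B`, `C`. -/
theorem exists_arch {n a b c : ℕ} {A B C k : ℤ} (hn : 0 < n) (hsum : a + b + c = n)
    (hAB : B ≡ A + 2 * (a + b) [ZMOD 4 * n]) (hBC : C ≡ B + 2 * (b + c) [ZMOD 4 * n])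
    (hk : Odd (k - A)) :
    ∃ i : Fin 3, ∃ j : ℕ, j < ![a, b, c] i ∧
      (outerEnd n k = outerEnd n (![A, B, C] i + (2 * j + 1)) ∨
        outerEnd n k = outerEnd n (![A, B, C] i - (2 * j + 1))) := by
  obtain ⟨m, h1, h2⟩ := exists_add_mul_mem_window hn A k
  obtain ⟨q, hq⟩ := hAB.dvd
  obtain ⟨q', hq'⟩ := hBC.dvd
  obtain ⟨r, hr⟩ := hk
  rw [← outerEnd_add_mul n k m]
  obtain ⟨d, hd⟩ : ∃ d : ℕ, k + 4 * n * m = A + (2 * d + 1) := by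
    have : Odd (k + 4 * n * m - A) := ⟨r + 2 * n * m, by linarith⟩
    obtain ⟨d, hd⟩ := this
    exact ⟨d.toNat, by omega⟩
  rw [hd]
  have hshift : ∀ u v w : ℤ, u = v + 4 * n * w → outerEnd n u = outerEnd n v := by
    rintro u v w rfl
    exact outerEnd_add_mul n v w
  -- Going once around from `A`, the odd positions form six runs of lengths `a`, `b`, `b`, `c`, `c`,
  -- `a`: after `A`, before and after `B`, before and after `C`, and before `A` again.
  rcases lt_or_ge d a with h3 | h3
  · exact ⟨0, d, h3, Or.inl rfl⟩
  rcases lt_or_ge d (a + b) with h4 | h4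
  · refine ⟨1, a + b - 1 - d, ?_, Or.inr (hshift _ _ q ?_)⟩
    · simp
      omega
    · simp only [Matrix.cons_val_one, Matrix.cons_val_zero]
      omega
  rcases lt_or_ge d (a + 2 * b) with h5 | h5
  · refine ⟨1, d - (a + b), ?_, Or.inl (hshift _ _ q ?_)⟩
    · simp
      omega
    · simp only [Matrix.cons_val_one, Matrix.cons_val_zero]
      omega
  rcases lt_or_ge d (a + 2 * b + c) with h6 | h6
  · refine ⟨2, a + 2 * b + c - 1 - d, ?_, Or.inr (hshift _ _ (q + q') ?_)⟩
    · simp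
      omega
    · simp only [Matrix.cons_val]
      rw [mul_add]
      omega
  rcases lt_or_ge d (a + 2 * b + 2 * c) with h7 | h7
  · refine ⟨2, d - (a + 2 * b + c), ?_, Or.inl (hshift _ _ (q + q') ?_)⟩
    · simp
      omega
    · simp only [Matrix.cons_val]
      rw [mul_add]
      omega
  · refine ⟨0, 2 * n - 1 - d, ?_, Or.inr (hshift _ _ 1 ?_)⟩
    · simp
      omega
    · simp only [Matrix.cons_val_zero]
      omega

theorem isOuterLeaf_outerEnd {n : ℕ} {H : SimpleGraph (ℤ × ℤ)} (hn : 0 < n)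
    {k : ℤ} (hk : ExternalOccupied n H k) : IsOuterLeaf n H (outerEnd n k) :=
  ⟨outerEnd_notMem hn k, _, hk.symm⟩

/-! ### Arches crossing an interval that avoids the centres -/

namespace IsFPLOfType

variable {n a b c : ℕ} {A B C : ℤ} {H : SimpleGraph (ℤ × ℤ)}

theorem nestedArches (h : IsFPLOfType n a b c A B C H) (i : Fin 3) :
    NestedArches n H (![A, B, C] i) (![a, b, c] i) := by
  fin_cases i
  · exact h.archesA
  · exact h.archesB
  · exact h.archesC

/-- The bounds on `m` are what `IsRingInterval.isInterior_or` needs: the next centre lies strictly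
beyond every arch around centre `i`, on both sides. -/
theorem exists_next (h : IsFPLOfType n a b c A B C H) (i : Fin 3) :
    ∃ i' : Fin 3, ∃ m : ℕ, (![a, b, c] i : ℕ) ≤ m ∧ m ≤ n ∧
      ![A, B, C] i' ≡ ![A, B, C] i + 2 * m [ZMOD 4 * n] := by
  have := h.sum_eq
  fin_cases i
  · exact ⟨1, a + b, by simp, by omega, by simpa using h.A_to_B⟩
  · exact ⟨2, b + c, by simp, by omega, by simpa using h.B_to_C⟩
  · refine ⟨0, c + a, by simp, by omega, ?_⟩
    obtain ⟨q, hq⟩ := h.A_to_B.dvd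
    obtain ⟨q', hq'⟩ := h.B_to_C.dvd
    rw [Int.modEq_iff_dvd]
    refine ⟨1 - q - q', ?_⟩
    simp only [Matrix.cons_val, Fin.reduceFinMk, Matrix.cons_val_zero]
    have : (n : ℤ) = a + b + c := by exact_mod_cast h.sum_eq.symm
    rw [mul_sub, mul_sub]
    push_cast
    linarith

/-- Each loose end in `D` has its partner, which is another loose end, outside of `D`, unless one
of the three centres is in the interior of the interval cut out by `D`. -/
theorem exists_partner (h : IsFPLOfType n a b c A B C H) (hn : 0 < n) {D : Set (ℤ × ℤ)}
    (hD : IsRingInterval n D) (hint : ∀ i : Fin 3, ¬ IsInterior n D (![A, B, C] i))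
    {o : ℤ × ℤ} (ho : o ∈ D) (hl : IsOuterLeaf n H o) :
    ∃ q ∉ D, H.Reachable o q ∧ IsOuterLeaf n H q := by
  obtain ⟨p, hp⟩ := h.isFPL.exists_parity
  obtain ⟨k, rfl, hk⟩ := (h.isFPL.hasPhase hp).exists_outerEnd_eq hl
  have hpar : ∀ i : Fin 3, Odd (![A, B, C] i + p) := fun i => by
    rw [← Int.not_even_iff_odd, ← hp]
    exact (h.nestedArches i).1
  have hkA : Odd (k - A) := by
    have := hpar 0
    simp only [Matrix.cons_val_zero, Int.odd_iff, Int.even_iff] at *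
    omega
  obtain ⟨i, j, hj, hij⟩ := exists_arch hn h.sum_eq h.A_to_B h.B_to_C hkA
  obtain ⟨i', m, hm, hmn, hnext⟩ := h.exists_next i
  have hreach := (h.nestedArches i).2 j hj
  have hpi := hpar i
  have hno : ¬ (outerEnd n (![A, B, C] i - (2 * j + 1)) ∈ D ∧
      outerEnd n (![A, B, C] i + (2 * j + 1)) ∈ D) := fun hh =>
    (hD.isInterior_or hn (by omega) (by omega) (by omega) (by omega) hnext hh.1 hh.2).elim
      (hint i) (hint i')
  have hleaf : ∀ k', Odd (k' - ![A, B, C] i) → IsOuterLeaf n H (outerEnd n k') := by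
    intro k' hk'
    refine isOuterLeaf_outerEnd hn ((hp k').mpr ?_)
    rw [Int.odd_iff] at hk' hpi
    rw [Int.even_iff]
    omega
  rcases hij with hij | hij
  · rw [hij] at ho ⊢
    exact ⟨_, fun hq => hno ⟨hq, ho⟩, hreach.symm, hleaf _ ⟨-j - 1, by ring⟩⟩
  · rw [hij] at ho ⊢
    exact ⟨_, fun hq => hno ⟨ho, hq⟩, hreach, hleaf _ ⟨j, by ring⟩⟩

/-- Partners outside `D` give the exits required by tightness. They also separate the paths: two
connected loose ends in `D`, with a partner outside, would be three vertices of degree one in a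
single component. -/
theorem exists_reachable_of_isTight (h : IsFPLOfType n a b c A B C H) (hn : 0 < n)
    {D : Set (ℤ × ℤ)} (hD : IsRingInterval n D)
    (hint : ∀ i : Fin 3, ¬ IsInterior n D (![A, B, C] i)) (ht : IsTight n H D) {u v : ℤ × ℤ}
    (hu : u ∈ D) (hv : v ∉ D) (huv : H.Adj u v) : ∃ o, IsOuterLeaf n H o ∧ H.Reachable u o := by
  obtain ⟨p, hp⟩ := h.isFPL.exists_parity
  have hph := h.isFPL.hasPhase hp
  refine ht (fun o ho hl => ?_) (fun o ho o' ho' hl hl' hr => ?_) u hu v hv huv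
  · obtain ⟨q, hq, hr, _⟩ := h.exists_partner hn hD hint ho hl
    exact ⟨q, hq, hr⟩
  · by_contra hne
    obtain ⟨q, hq, hrq, hlq⟩ := h.exists_partner hn hD hint ho hl
    exact hph.atMostTwoNeighbours.not_reachable_of_reachable (hph.atMostOneNeighbour hl.1)
      (hph.atMostOneNeighbour hl'.1) (hph.atMostOneNeighbour hlq.1) hne
      (fun e => hq (e ▸ ho)) (fun e => hq (e ▸ ho')) hr hrq

/-- Of four sets whose intervals have disjoint interiors, one contains none of the three centres. -/
theorem exists_forall_not_isInterior (A B C : ℤ) (D : Fin 4 → Set (ℤ × ℤ))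
    (hD : ∀ s t, s < t → ∀ X, IsInterior n (D s) X → ¬ IsInterior n (D t) X) :
    ∃ s, ∀ i : Fin 3, ¬ IsInterior n (D s) (![A, B, C] i) := by
  by_contra! hc
  -- Otherwise four sets would each claim one of three centres, and two of them would share it.
  choose f hf using hc
  obtain ⟨s, t, hst, hfst⟩ := Fintype.exists_ne_map_eq_of_card_lt f (by simp)
  rcases lt_or_gt_of_ne hst with hlt | hlt
  · exact hD s t hlt _ (hf s) (hfst ▸ hf t)
  · exact hD t s hlt _ (hf t) (hfst ▸ hf s)

end IsFPLOfType

/-! ### Disjointness of the interiors of the four intervals -/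

/-- The outer endpoints on the two sides of the `X`-th one. -/
theorem outerEnd_sub_one_add_one {n : ℕ} (hn : 0 < n) (X : ℤ) :
    ∃ k : ℤ, 0 ≤ k ∧ k < 4 * n ∧ outerEnd n (X - 1) = outerEnd n k ∧
      (k + 2 < 4 * n ∧ outerEnd n (X + 1) = outerEnd n (k + 2) ∨
        4 * n ≤ k + 2 ∧ outerEnd n (X + 1) = outerEnd n (k + 2 - 4 * n)) := by
  obtain ⟨m, h1, h2⟩ := exists_add_mul_mem_window hn 0 (X - 1)
  refine ⟨X - 1 + 4 * n * m, h1, by omega, (outerEnd_add_mul n _ m).symm, ?_⟩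
  rcases lt_or_ge (X - 1 + 4 * n * m + 2) (4 * n) with h | h
  · refine Or.inl ⟨h, ?_⟩
    rw [← outerEnd_add_mul n _ m]
    congr 1
    ring
  · refine Or.inr ⟨h, ?_⟩
    rw [← outerEnd_add_mul n _ (m - 1)]
    congr 1
    ring

/-- The cones do overlap beyond the grid, but only in a strip of two adjacent diagonals `w.1 + w.2 =
const`, too narrow to contain the outer endpoints on both sides of `X`. -/
theorem not_isInterior_both_north_west {n : ℕ} {x y : ℤ} (hz : (x, y) ∈ gridVertices n) (X : ℤ)
    (h₁ : IsInterior n (northCone x y) X) : ¬ IsInterior n (westCone x (y + 1)) X := by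
  intro h₂
  have hn : 0 < n := by
    simp only [gridVertices, Set.mem_ofPred_eq] at hz
    omega
  obtain ⟨k, h0, h4, hP, hQ⟩ := outerEnd_sub_one_add_one hn X
  simp only [IsInterior, hP] at h₁ h₂
  have e := outerEnd_of_lt h0 h4
  rcases hQ with ⟨hk, hQ⟩ | ⟨hk, hQ⟩ <;> rw [hQ] at h₁ h₂
  · have e' := outerEnd_of_lt (n := n) (k := k + 2) (by omega) hk
    simp only [gridVertices, northCone, westCone, Set.mem_ofPred_eq, Prod.ext_iff] at *
    rcases e with e | e | e | e <;> omega
  · have e' := outerEnd_of_lt (n := n) (k := k + 2 - 4 * n) (by omega) (by omega)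
    simp only [gridVertices, northCone, westCone, Set.mem_ofPred_eq, Prod.ext_iff] at *
    rcases e with e | e | e | e <;> omega

theorem not_isInterior_both_east_south {n : ℕ} {x y : ℤ} (hz : (x, y) ∈ gridVertices n) (X : ℤ)
    (h₁ : IsInterior n (eastCone x y) X) : ¬ IsInterior n (southCone (x + 1) y) X := by
  intro h₂
  have hn : 0 < n := by
    simp only [gridVertices, Set.mem_ofPred_eq] at hz
    omega
  obtain ⟨k, h0, h4, hP, hQ⟩ := outerEnd_sub_one_add_one hn X
  simp only [IsInterior, hP] at h₁ h₂
  have e := outerEnd_of_lt h0 h4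
  rcases hQ with ⟨hk, hQ⟩ | ⟨hk, hQ⟩ <;> rw [hQ] at h₁ h₂
  · have e' := outerEnd_of_lt (n := n) (k := k + 2) (by omega) hk
    simp only [gridVertices, eastCone, southCone, Set.mem_ofPred_eq, Prod.ext_iff] at *
    rcases e with e | e | e | e <;> omega
  · have e' := outerEnd_of_lt (n := n) (k := k + 2 - 4 * n) (by omega) (by omega)
    simp only [gridVertices, eastCone, southCone, Set.mem_ofPred_eq, Prod.ext_iff] at *
    rcases e with e | e | e | e <;> omega

theorem not_isInterior_both_of_inter_subset {n : ℕ} (hn : 0 < n) {D D' : Set (ℤ × ℤ)}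
    (hD : D ∩ D' ⊆ gridVertices n) (X : ℤ) (h : IsInterior n D X) : ¬ IsInterior n D' X :=
  fun h' => outerEnd_notMem hn _ (hD ⟨h.1, h'.1⟩)

/-! ### The extremal corner and the conclusion -/

namespace IsFPLOfType

variable {n a b c : ℕ} {A B C : ℤ} {H : SimpleGraph (ℤ × ℤ)}

/-- A vertex whose two edges go to the right and upwards is connected to a loose end. -/
theorem exists_reachable_of_corner (h : IsFPLOfType n a b c A B C H) {x y : ℤ}
    (hz : (x, y) ∈ gridVertices n) (hr : (x + 1, y) ∈ gridVertices n)
    (ht : (x, y + 1) ∈ gridVertices n) (hzr : H.Adj (x, y) (x + 1, y))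
    (hzt : H.Adj (x, y) (x, y + 1)) : ∃ o, IsOuterLeaf n H o ∧ H.Reachable (x, y) o := by
  have hn : 0 < n := by
    simp only [gridVertices, Set.mem_ofPred_eq] at hz
    omega
  obtain ⟨p, hp⟩ := h.isFPL.exists_parity
  have hph := h.isFPL.hasPhase hp
  have hr' : (∃ o, IsOuterLeaf n H o ∧ H.Reachable (x + 1, y) o) →
      ∃ o, IsOuterLeaf n H o ∧ H.Reachable (x, y) o :=
    fun ⟨o, ho, hro⟩ => ⟨o, ho, hzr.reachable.trans hro⟩
  have ht' : (∃ o, IsOuterLeaf n H o ∧ H.Reachable (x, y + 1) o) →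
      ∃ o, IsOuterLeaf n H o ∧ H.Reachable (x, y) o :=
    fun ⟨o, ho, hro⟩ => ⟨o, ho, hzt.reachable.trans hro⟩
  -- North and south cones need an apex of even parity, east and west cones one of odd parity. So
  -- two opposite cones have their apex at the corner itself and the other two at its neighbours.
  -- Each is crossed by one of the two edges at the corner. Only one pair of cones can meet outside
  -- the grid.
  rcases Int.even_or_odd (x + y + p) with hpar | hpar
  · obtain ⟨s, hs⟩ := exists_forall_not_isInterior (n := n) A B C
      ![southCone x y, northCone x y, eastCone (x + 1) y, westCone x (y + 1)] (by
        intro s t hst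
        fin_cases s <;> fin_cases t <;> first
          | exact absurd hst (by decide)
          | exact not_isInterior_both_north_west hz
          | (refine not_isInterior_both_of_inter_subset hn fun w hw => ?_
             simp [southCone, northCone, eastCone, westCone, gridVertices] at hw hz ⊢
             omega))
    have hpar' : Odd (x + 1 + y + p) ∧ Odd (x + (y + 1) + p) := by
      simp only [Int.even_iff, Int.odd_iff] at *
      omega
    fin_cases s
    · exact h.exists_reachable_of_isTight hn (isRingInterval_southCone hz) hs
        (hph.isTight_southCone hpar hz.2.2.2) (by simp [southCone]) (by simp [southCone]) hzr
    · exact h.exists_reachable_of_isTight hn (isRingInterval_northCone hz) hs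
        (hph.isTight_northCone hpar hz.2.2.1) (by simp [northCone]) (by simp [northCone]) hzr
    · exact hr' (h.exists_reachable_of_isTight hn (isRingInterval_eastCone hr) hs
        (hph.isTight_eastCone hpar'.1 hr.1) (by simp [eastCone])
        (by simp [eastCone]) hzr.symm)
    · exact ht' (h.exists_reachable_of_isTight hn (isRingInterval_westCone ht) hs
        (hph.isTight_westCone hpar'.2 ht.2.1) (by simp [westCone])
        (by simp [westCone]; omega) hzt.symm)
  · obtain ⟨s, hs⟩ := exists_forall_not_isInterior (n := n) A B C
      ![eastCone x y, southCone (x + 1) y, westCone x y, northCone x (y + 1)] (by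
        intro s t hst
        fin_cases s <;> fin_cases t <;> first
          | exact absurd hst (by decide)
          | exact not_isInterior_both_east_south hz
          | (refine not_isInterior_both_of_inter_subset hn fun w hw => ?_
             simp [southCone, northCone, eastCone, westCone, gridVertices] at hw hz ⊢
             omega))
    have hpar' : Even (x + 1 + y + p) ∧ Even (x + (y + 1) + p) := by
      simp only [Int.even_iff, Int.odd_iff] at *
      omega
    fin_cases s
    · exact h.exists_reachable_of_isTight hn (isRingInterval_eastCone hz) hs
        (hph.isTight_eastCone hpar hz.1) (by simp [eastCone]) (by simp [eastCone]; omega) hzt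
    · exact hr' (h.exists_reachable_of_isTight hn (isRingInterval_southCone hr) hs
        (hph.isTight_southCone hpar'.1 hr.2.2.2) (by simp [southCone])
        (by simp [southCone]) hzr.symm)
    · exact h.exists_reachable_of_isTight hn (isRingInterval_westCone hz) hs
        (hph.isTight_westCone hpar hz.2.1) (by simp [westCone]) (by simp [westCone]) hzr
    · exact ht' (h.exists_reachable_of_isTight hn (isRingInterval_northCone ht) hs
        (hph.isTight_northCone hpar'.2 ht.2.2.1) (by simp [northCone])
        (by simp [northCone]) hzt.symm)

/-- Every vertex of the grid is connected to a loose end. -/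
theorem exists_reachable (h : IsFPLOfType n a b c A B C H) {v : ℤ × ℤ}
    (hv : v ∈ gridVertices n) : ∃ o, IsOuterLeaf n H o ∧ H.Reachable v o := by
  classical
  by_contra hno
  let S := (framedGrid n).filter fun w => w ∈ gridVertices n ∧
    ¬ ∃ o, IsOuterLeaf n H o ∧ H.Reachable w o
  have hmem : ∀ w, w ∈ S ↔ w ∈ gridVertices n ∧ ¬ ∃ o, IsOuterLeaf n H o ∧ H.Reachable w o := by
    intro w
    refine Finset.mem_filter.trans (and_iff_right_of_imp fun hw => ?_)
    obtain ⟨hw1, hw2, hw3, hw4⟩ := hw.1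
    simp only [framedGrid, Finset.mem_product, Finset.mem_Icc]
    omega
  -- Neighbours of a vertex in `S` are again in `S`, a neighbour outside the grid being itself a
  -- loose end. Minimality of `x + y` thus excludes edges to the left and downwards.
  obtain ⟨⟨x, y⟩, hzS, hmin⟩ := S.exists_min_image (fun w => w.1 + w.2)
    ⟨v, (hmem v).mpr ⟨hv, hno⟩⟩
  obtain ⟨hz, hzno⟩ := (hmem _).mp hzS
  have hnb : ∀ w, H.Adj (x, y) w → w ∈ S := by
    intro w hw
    rw [hmem]
    refine ⟨?_, fun ⟨o, ho, hro⟩ => hzno ⟨o, ho, hw.reachable.trans hro⟩⟩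
    by_contra hwg
    exact hzno ⟨w, ⟨hwg, _, hw.symm⟩, hw.reachable⟩
  have hsub : H.neighborSet (x, y) ⊆ {(x + 1, y), (x, y + 1)} := by
    intro w hw
    have h1 := hmin w (hnb w hw)
    have h2 := (h.isFPL.neighbour_of_adj _ _ hw).eq_or
    simp only [Set.mem_insert_iff, Set.mem_singleton_iff, Prod.ext_iff] at *
    omega
  have heq := Set.eq_of_subset_of_ncard_le hsub
    (by rw [h.isFPL.two_edges _ hz]; exact Set.ncard_insert_le _ _ |>.trans (by simp))
  have hzr : H.Adj (x, y) (x + 1, y) := by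
    rw [← SimpleGraph.mem_neighborSet, heq]
    simp
  have hzt : H.Adj (x, y) (x, y + 1) := by
    rw [← SimpleGraph.mem_neighborSet, heq]
    simp
  exact hzno (h.exists_reachable_of_corner hz ((hmem _).mp (hnb _ hzr)).1
    ((hmem _).mp (hnb _ hzt)).1 hzr hzt)

end IsFPLOfType

theorem corollary2 (n a b c : ℕ) (A B C : ℤ) (H : SimpleGraph (ℤ × ℤ))
    (hH : IsFPLOfType n a b c A B C H) : H.IsAcyclic := by
  obtain ⟨p, hp⟩ := hH.isFPL.exists_parity
  have hph := hH.isFPL.hasPhase hp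
  refine hph.atMostTwoNeighbours.isAcyclic fun v => ?_
  by_cases hv : v ∈ gridVertices n
  · obtain ⟨o, ho, hvo⟩ := hH.exists_reachable hv
    exact ⟨o, hph.atMostOneNeighbour ho.1, hvo⟩
  · exact ⟨v, hph.atMostOneNeighbour hv, SimpleGraph.Reachable.refl v⟩
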